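/- Let $d\ge 0$ and $N\ge 0$ be integers with $N\ge 2d-1$, and let $r_1,\dots,r_N$ be integers with $1\le r_j\le d$ for all $j$. A tuple $\mathcal A=(A_j)_{j=1}^N$ of real symmetric $d\times d$ matrices has the phase retrieval property in $\mathbb R^d$ if the map $$\mathbf M_{\mathcal A}:\ \mathbb R^d/\{\pm1\}\to\mathbb R^N,\qquad \underline{\mathbf x}\mapsto(\mathbf x^\top A_1\mathbf x,\dots,\mathbf x^\top A_N\mathbf x)$$ is injective; here $\mathbf x,\mathbf y\in\mathbb R^d$ are identified if $\mathbf x=b\,\mathbf y$ for some $b\in\mathbb R$ with $|b|=1$. Let $$S=\{(A_j)_{j=1}^N: A_j\in\mathbb R^{d\times d}\text{ symmetric},\ \operatorname{rank}A_j=r_j\ \text{for all } j\},$$ $$S^+=\{(A_j)_{j=1}^N\in S: A_j\text{ positive semidefinite for all } j\}.$$ For a semialgebraic subset $T$ of a real affine space $\mathbb R^n$, its real dimension $\dim_{\mathbb R}T$ is the Krull dimension of $\mathbb R[x_1,\dots,x_n]/\mathbf I(T)$, where $\mathbf I(T)$ is the ideal of real polynomials vanishing on $T$ (equivalently, the largest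 dimension of an open hypercube in a semialgebraic decomposition of $T$ into open hypercubes); $\dim_{\mathbb R}\emptyset=-\infty$. A property is said to hold for a generic element of a semialgebraic set $T\subset(\mathbb R^{d\times d})^N$ if there is a real algebraic set $Z\subset(\mathbb R^{d\times d})^N$ with $\dim_{\mathbb R}Z<\dim_{\mathbb R}T$ such that the property holds for every element of $T\setminus Z$. Then a generic $\mathcal A\in S$ has the phase retrieval property in $\mathbb R^d$, and a generic $\mathcal A\in S^+$ has the phase retrieval property in $\mathbb R^d$. -/

import Mathlib

namespace PhaseRetrieval

/-- `x ∼ y` iff `x = b y` for a real scalar `b` with `|b| = 1`. -/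
def phaseSetoid (d : ℕ) : Setoid (Fin d → ℝ) where
  r x y := ∃ b : ℝ, |b| = 1 ∧ x = b • y
  iseqv :=
    { refl := fun x => ⟨1, by simp, by simp⟩
      symm := by
        rintro x y ⟨b, hb, rfl⟩
        have hb0 : b ≠ 0 := by
          rintro rfl
          simp at hb
        exact ⟨b⁻¹, by rw [abs_inv, hb, inv_one], by rw [smul_smul, inv_mul_cancel₀ hb0, one_smul]⟩
      trans := by
        rintro x y z ⟨b, hb, rfl⟩ ⟨c, hc, rfl⟩
        exact ⟨b * c, by rw [abs_mul, hb, hc, one_mul], by rw [smul_smul]⟩ }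

/-- The measurements `(xᵀ A₁ x, …, xᵀ A_N x)`. -/
def measurement {N d : ℕ} (A : Fin N → Matrix (Fin d) (Fin d) ℝ) (x : Fin d → ℝ) : Fin N → ℝ :=
  fun j => x ⬝ᵥ ((A j).mulVec x)

theorem measurement_eq_of_phase {N d : ℕ} (A : Fin N → Matrix (Fin d) (Fin d) ℝ)
    (x y : Fin d → ℝ) (h : (phaseSetoid d).r x y) : measurement A x = measurement A y := by
  obtain ⟨b, hb, rfl⟩ := h
  have hbb : b * b = 1 := by rw [← abs_mul_abs_self, hb, one_mul]
  funext j
  simp only [measurement, Matrix.mulVec_smul, smul_dotProduct, dotProduct_smul, smul_eq_mul]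
  rw [← mul_assoc, hbb, one_mul]

/-- The measurement map on `ℝ^d / ∼`. -/
def measurementMap {N d : ℕ} (A : Fin N → Matrix (Fin d) (Fin d) ℝ) :
    Quotient (phaseSetoid d) → (Fin N → ℝ) :=
  Quotient.lift (measurement A) (measurement_eq_of_phase A)

/-- `A` has the phase retrieval property in `ℝ^d`. -/
def IsPhaseRetrievable {N d : ℕ} (A : Fin N → Matrix (Fin d) (Fin d) ℝ) : Prop :=
  Function.Injective (measurementMap A)

/-- The matrix entries of a tuple, as a point of real affine space of dimension `N d²`. -/
def entries {N d : ℕ} (A : Fin N → Matrix (Fin d) (Fin d) ℝ) : Fin N × Fin d × Fin d → ℝ :=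
  fun k => A k.1 k.2.1 k.2.2

/-- Real algebraic sets: common real zero loci of sets of real polynomials. -/
def IsRealAlgebraic {σ : Type*} (Z : Set (σ → ℝ)) : Prop :=
  ∃ F : Set (MvPolynomial σ ℝ), Z = {x | ∀ f ∈ F, MvPolynomial.eval x f = 0}

/-- The ideal of all real polynomials that vanish on `S`. -/
noncomputable def idealOf {σ : Type*} (S : Set (σ → ℝ)) : Ideal (MvPolynomial σ ℝ) :=
  MvPolynomial.vanishingIdeal ℝ S

/-- The real dimension of a (semialgebraic) subset `S` of real affine space: the Krull dimension of
`ℝ[x] / I(S)`. For semialgebraic `S` it is the largest dimension of a cell in a decomposition of `S`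
into open hypercubes. The empty set has dimension `⊥`. -/
noncomputable def realDim {σ : Type*} (S : Set (σ → ℝ)) : WithBot ℕ∞ :=
  ringKrullDim (MvPolynomial σ ℝ ⧸ idealOf S)

/-- `P` holds for a generic tuple in `S`: it holds at every point of `S` outside a real algebraic
set whose dimension is smaller than that of `S`. -/
def HoldsGenerically {N d : ℕ} (S : Set (Fin N → Matrix (Fin d) (Fin d) ℝ))
    (P : (Fin N → Matrix (Fin d) (Fin d) ℝ) → Prop) : Prop :=
  ∃ Z : Set (Fin N × Fin d × Fin d → ℝ), IsRealAlgebraic Z ∧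
    realDim Z < realDim (entries '' S) ∧ ∀ A ∈ S, entries A ∉ Z → P A

/-- Tuples of real symmetric matrices with prescribed ranks. -/
def symmetricTuples {N d : ℕ} (r : Fin N → ℕ) : Set (Fin N → Matrix (Fin d) (Fin d) ℝ) :=
  {A | ∀ j, (A j).IsSymm ∧ (A j).rank = r j}

/-- Tuples of real (symmetric) positive semidefinite matrices with prescribed ranks. -/
def posSemidefTuples {N d : ℕ} (r : Fin N → ℕ) : Set (Fin N → Matrix (Fin d) (Fin d) ℝ) :=
  {A | ∀ j, (A j).PosSemidef ∧ (A j).rank = r j}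

end PhaseRetrieval

/-! If `x` and `y` have equal measurements, then `u = x + y` and `v = x - y` satisfy `uᵀ A_j v = 0`
for all `j`; so when phase retrieval fails, all the `A_j` share a pair of nonzero orthogonal
vectors. After scaling, the pair has `2(d-1) < N` free entries, while each `j` imposes a nontrivial
condition on `A_j`. A parameter count then suggests that bad tuples satisfy an extra polynomial
equation.

The count is made with transcendence degrees. A symmetric matrix of rank `r` with invertible leading
block `P` and first `r` columns `C` equals `C P⁻¹ Cᵀ`, so its entries indexed by `Coord d r` are
free coordinates. If the coordinates of bad tuples satisfied no common nonzero polynomial, an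
ultraproduct would give a field with a bad pair for algebraically independent coordinates. Adjoining
the `2(d-1)` entries of the pair spoils at most that many coordinates, so some `A_j` keeps all of
its own. This contradicts `dotProduct_adjProduct_fill_X_ne_zero`.

For the dimensions, both sets of tuples have the same vanishing ideal as the image of the rational
chart (`idealOf_entries_eq`). This ideal is prime, so one further equation lowers the Krull
dimension. -/

namespace PhaseRetrieval

open Matrix

/-! ### Identities for the leading block and its adjugate -/

section Block

variable {d r : ℕ} {R S : Type*}

/-- The leading `r × r` block of a `d × d` matrix. -/
def headBlock (hr : r ≤ d) (M : Matrix (Fin d) (Fin d) R) : Matrix (Fin r) (Fin r) R :=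
  M.submatrix (Fin.castLE hr) (Fin.castLE hr)

/-- The first `r` columns of a `d × d` matrix. -/
def headCols (hr : r ≤ d) (M : Matrix (Fin d) (Fin d) R) : Matrix (Fin d) (Fin r) R :=
  M.submatrix id (Fin.castLE hr)

theorem headBlock_eq (hr : r ≤ d) (M : Matrix (Fin d) (Fin d) R) :
    headBlock hr M = (headCols hr M).submatrix (Fin.castLE hr) id := rfl

theorem headBlock_map (hr : r ≤ d) (f : R → S) (M : Matrix (Fin d) (Fin d) R) :
    headBlock hr (M.map f) = (headBlock hr M).map f := rfl

theorem headCols_map (hr : r ≤ d) (f : R → S) (M : Matrix (Fin d) (Fin d) R) :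
    headCols hr (M.map f) = (headCols hr M).map f := rfl

theorem headBlock_isSymm (hr : r ≤ d) {M : Matrix (Fin d) (Fin d) R} (hM : M.IsSymm) :
    (headBlock hr M).IsSymm := hM.submatrix _

variable [CommRing R] [CommRing S]

/-- `C adj(P) Cᵀ`, where `C` is the block of the first `r` columns and `P` the leading block. -/
def adjProduct (hr : r ≤ d) (M : Matrix (Fin d) (Fin d) R) : Matrix (Fin d) (Fin d) R :=
  headCols hr M * (headBlock hr M).adjugate * (headCols hr M)ᵀ

/-- Positions of the independent entries of a symmetric `d × d` matrix of rank `r` whose leading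
`r × r` block is invertible. -/
abbrev Coord (d r : ℕ) : Type := {p : Fin d × Fin d // p.1 ≤ p.2 ∧ (p.1 : ℕ) < r}

/-- The symmetric matrix with prescribed entries in the first `r` rows and columns, and zeros
elsewhere. -/
def fill (a : Coord d r → R) : Matrix (Fin d) (Fin d) R := fun i k =>
  if h : ((min i k : Fin d) : ℕ) < r then a ⟨(min i k, max i k), min_le_max, h⟩ else 0

/-- The entries of a matrix at the independent positions. -/
def coords (M : Matrix (Fin d) (Fin d) R) : Coord d r → R := fun p => M p.1.1 p.1.2

theorem fill_isSymm (a : Coord d r → R) : (fill a).IsSymm := by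
  ext i k
  simp only [Matrix.transpose_apply, fill, min_comm k i, max_comm k i]

theorem fill_coord (a : Coord d r → R) (p : Coord d r) : fill a p.1.1 p.1.2 = a p := by
  obtain ⟨⟨i, k⟩, hik, hi⟩ := p
  simp only at hik hi
  simp [fill, min_eq_left hik, max_eq_right hik, hi]

theorem headCols_fill_coords (hr : r ≤ d) {M : Matrix (Fin d) (Fin d) R} (hM : M.IsSymm) :
    headCols hr (fill (coords M : Coord d r → R)) = headCols hr M := by
  ext i k
  have hk : ((min i (Fin.castLE hr k) : Fin d) : ℕ) < r :=
    lt_of_le_of_lt (Fin.le_def.1 (min_le_right _ _)) (by simp)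
  simp only [headCols, submatrix_apply, id, fill, hk, dif_pos, coords]
  rcases le_total i (Fin.castLE hr k) with h | h
  · rw [min_eq_left h, max_eq_right h]
  · rw [min_eq_right h, max_eq_left h, hM.apply]

theorem headBlock_fill_coords (hr : r ≤ d) {M : Matrix (Fin d) (Fin d) R} (hM : M.IsSymm) :
    headBlock hr (fill (coords M : Coord d r → R)) = headBlock hr M := by
  rw [headBlock_eq, headBlock_eq, headCols_fill_coords hr hM]

theorem adjProduct_fill_coords (hr : r ≤ d) {M : Matrix (Fin d) (Fin d) R} (hM : M.IsSymm) :
    adjProduct hr (fill (coords M : Coord d r → R)) = adjProduct hr M := by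
  rw [adjProduct, adjProduct, headBlock_fill_coords hr hM, headCols_fill_coords hr hM]

theorem fill_map (f : R →+* S) (a : Coord d r → R) : (fill a).map f = fill (f ∘ a) := by
  ext i k
  simp only [map_apply, fill]
  split_ifs <;> simp

theorem det_headBlock_map (hr : r ≤ d) (f : R →+* S) (M : Matrix (Fin d) (Fin d) R) :
    (headBlock hr (M.map f)).det = f (headBlock hr M).det := by
  rw [headBlock_map, RingHom.map_det]; rfl

theorem adjProduct_map (hr : r ≤ d) (f : R →+* S) (M : Matrix (Fin d) (Fin d) R) :
    adjProduct hr (M.map f) = (adjProduct hr M).map f := by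
  simp only [adjProduct, headBlock_map, headCols_map, Matrix.map_mul, Matrix.transpose_map]
  congr 2
  exact (RingHom.map_adjugate f (headBlock hr M)).symm

theorem map_dotProduct_adjProduct_fill (hr : r ≤ d) (f : R →+* S) (a : Coord d r → R)
    (u v : Fin d → R) :
    f (u ⬝ᵥ adjProduct hr (fill a) *ᵥ v) =
      (f ∘ u) ⬝ᵥ adjProduct hr (fill (f ∘ a)) *ᵥ (f ∘ v) := by
  rw [RingHom.map_dotProduct]
  congr 1
  ext1 i
  rw [Function.comp_apply, RingHom.map_mulVec, ← adjProduct_map, fill_map]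

theorem adjugate_isSymm {n : Type*} [Fintype n] [DecidableEq n] {M : Matrix n n R}
    (hM : M.IsSymm) : M.adjugate.IsSymm := by
  rw [Matrix.IsSymm, adjugate_transpose, hM.eq]

theorem adjProduct_isSymm (hr : r ≤ d) {M : Matrix (Fin d) (Fin d) R} (hM : M.IsSymm) :
    (adjProduct hr M).IsSymm := by
  rw [Matrix.IsSymm, adjProduct, transpose_mul, transpose_mul, transpose_transpose,
    (adjugate_isSymm (headBlock_isSymm hr hM)).eq, Matrix.mul_assoc]

theorem headCols_adjProduct (hr : r ≤ d) {M : Matrix (Fin d) (Fin d) R} (hM : M.IsSymm) :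
    headCols hr (adjProduct hr M) = (headBlock hr M).det • headCols hr M := by
  have h : headCols hr (adjProduct hr M) =
      headCols hr M * (headBlock hr M).adjugate * (headBlock hr M)ᵀ := by
    ext i k
    simp [headCols, adjProduct, Matrix.mul_apply, headBlock]
  rw [h, (headBlock_isSymm hr hM).eq, Matrix.mul_assoc, adjugate_mul, Matrix.mul_smul,
    Matrix.mul_one]

/-- The leading block of `Wᵀ W` is `Vᵀ V`, whose adjugate factors as `adj V * adj Vᵀ`, and the
product telescopes. Gram matrices thus serve as test points where `adjProduct` is explicit. -/
theorem adjProduct_transpose_mul_self (hr : r ≤ d) (W : Matrix (Fin r) (Fin d) R) :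
    adjProduct hr (Wᵀ * W) = (W.submatrix id (Fin.castLE hr)).det ^ 2 • (Wᵀ * W) := by
  set V := W.submatrix id (Fin.castLE hr) with hV
  have h1 : headCols hr (Wᵀ * W) = Wᵀ * V := rfl
  have h2 : headBlock hr (Wᵀ * W) = Vᵀ * V := rfl
  rw [adjProduct, h1, h2, adjugate_mul_distrib, transpose_mul, transpose_transpose]
  calc Wᵀ * V * (V.adjugate * Vᵀ.adjugate) * (Vᵀ * W)
      = Wᵀ * (V * V.adjugate) * (Vᵀ.adjugate * Vᵀ) * W := by simp only [Matrix.mul_assoc]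
    _ = V.det ^ 2 • (Wᵀ * W) := by
      rw [mul_adjugate, adjugate_mul, det_transpose]
      simp [smul_smul, pow_two]

end Block

/-! ### Orthogonality as a nontrivial polynomial condition -/

section Generic

variable {d r : ℕ} {R : Type*} [CommRing R]

theorem sum_C_mul_X_ne_zero {u : Fin d → R} (hu : u ≠ 0) :
    ∑ i, MvPolynomial.X i * MvPolynomial.C (u i) ≠ (0 : MvPolynomial (Fin d) R) := by
  obtain ⟨i, hi⟩ := Function.ne_iff.1 hu
  intro h
  apply hi
  have := congrArg (MvPolynomial.aeval (Pi.single i (1 : R))) h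
  simpa [Pi.single_apply] using this

variable [IsDomain R]

theorem det_submatrix_mvPolynomialX_ne_zero (hr : r ≤ d) :
    ((mvPolynomialX (Fin r) (Fin d) R).submatrix id (Fin.castLE hr)).det ≠ 0 := by
  intro h
  have h1 := congrArg (MvPolynomial.aeval
    (fun p : Fin r × Fin d => if Fin.castLE hr p.1 = p.2 then (1 : R) else 0)) h
  rw [AlgHom.map_det, map_zero] at h1
  have h2 : (MvPolynomial.aeval
      (fun p : Fin r × Fin d => if Fin.castLE hr p.1 = p.2 then (1 : R) else 0)).mapMatrix
      ((mvPolynomialX (Fin r) (Fin d) R).submatrix id (Fin.castLE hr)) = 1 := by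
    ext i k
    simp [mvPolynomialX, Matrix.one_apply]
  rw [h2, det_one] at h1
  exact one_ne_zero h1

/-- Setting all rows of the generic matrix except the first to zero leaves a product of two nonzero
linear forms. Positivity of `r` provides that row. -/
theorem dotProduct_mvPolynomialX_mulVec_ne_zero (hr0 : 0 < r) {u v : Fin d → R} (hu : u ≠ 0)
    (hv : v ≠ 0) :
    (mvPolynomialX (Fin r) (Fin d) R *ᵥ (MvPolynomial.C ∘ u)) ⬝ᵥ
      (mvPolynomialX (Fin r) (Fin d) R *ᵥ (MvPolynomial.C ∘ v)) ≠ 0 := by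
  intro h
  have h1 := congrArg (MvPolynomial.aeval (fun p : Fin r × Fin d =>
    if p.1 = ⟨0, hr0⟩ then (MvPolynomial.X p.2 : MvPolynomial (Fin d) R) else 0)) h
  simp only [dotProduct, mulVec, map_sum, map_mul, mvPolynomialX_apply, MvPolynomial.aeval_X,
    Function.comp_apply, MvPolynomial.algHom_C, MvPolynomial.algebraMap_eq, map_zero] at h1
  rw [Finset.sum_eq_single ⟨0, hr0⟩ (by intro b _ hb; simp [hb]) (by simp)] at h1
  simp only [if_true] at h1
  exact mul_ne_zero (sum_C_mul_X_ne_zero hu) (sum_C_mul_X_ne_zero hv) h1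

/-- Orthogonality of two fixed nonzero vectors with respect to a symmetric matrix of rank `r` is a
nontrivial condition on the independent entries of that matrix. -/
theorem dotProduct_adjProduct_fill_X_ne_zero (hr : r ≤ d) (hr0 : 0 < r) {u v : Fin d → R}
    (hu : u ≠ 0) (hv : v ≠ 0) :
    (MvPolynomial.C ∘ u) ⬝ᵥ adjProduct hr (fill (MvPolynomial.X (R := R) (σ := Coord d r))) *ᵥ
      (MvPolynomial.C ∘ v) ≠ 0 := by
  intro h
  -- Specialise to the Gram matrix of a generic `r × d` matrix: the form becomes `det V ^ 2 * (W u
  -- ⬝ᵥ W v)`, with both factors nonzero.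
  set W := mvPolynomialX (Fin r) (Fin d) R with hW
  have hs : (Wᵀ * W).IsSymm := by rw [Matrix.IsSymm, transpose_mul, transpose_transpose]
  set φ : MvPolynomial (Coord d r) R →ₐ[R] MvPolynomial (Fin r × Fin d) R :=
    MvPolynomial.aeval (coords (Wᵀ * W)) with hφ
  have h1 := congrArg φ.toRingHom h
  have hc : ∀ w : Fin d → R, φ.toRingHom ∘ MvPolynomial.C ∘ w = MvPolynomial.C ∘ w := by
    intro w; ext1 i; exact MvPolynomial.algHom_C φ (w i)
  have hX : φ.toRingHom ∘ MvPolynomial.X = coords (Wᵀ * W) := by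
    ext1 p; exact MvPolynomial.aeval_X _ _
  rw [map_zero, map_dotProduct_adjProduct_fill, hX, hc, hc, adjProduct_fill_coords hr hs,
    adjProduct_transpose_mul_self, smul_mulVec, dotProduct_smul, ← mulVec_mulVec,
    dotProduct_mulVec, vecMul_transpose, smul_eq_mul] at h1
  exact mul_ne_zero (pow_ne_zero 2 (det_submatrix_mvPolynomialX_ne_zero hr))
    (dotProduct_mvPolynomialX_mulVec_ne_zero hr0 hu hv) h1

end Generic

/-! ### The rational chart of symmetric matrices of rank `r` -/

section Rank

variable {d r : ℕ} {F : Type*} [Field F]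

/-- The first `r` rows `B` of `A` already have rank `r`, so `A` and `B` have the same kernel. With
`E` the inclusion of the first `r` coordinates, `B E = P`, so `B` kills `det P - E adj(P) B`. Hence
`A` kills it too, which is the identity. -/
theorem det_headBlock_smul_eq_adjProduct (hr : r ≤ d) {A : Matrix (Fin d) (Fin d) F}
    (hA : A.IsSymm) (hrank : A.rank ≤ r) (hdet : (headBlock hr A).det ≠ 0) :
    (headBlock hr A).det • A = adjProduct hr A := by
  set B : Matrix (Fin r) (Fin d) F := A.submatrix (Fin.castLE hr) id with hB
  set P := headBlock hr A with hP
  have hBC : (headCols hr A)ᵀ = B := by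
    ext k i; exact hA.apply _ _
  have hrB : r ≤ B.rank := by
    have h1 : P.rank = r := by simpa using rank_of_det_ne_zero hdet
    calc r = (B.submatrix id (Fin.castLE hr)).rank := h1.symm
      _ ≤ B.rank := rank_submatrix_le _ _ _
  have hle : LinearMap.ker A.mulVecLin ≤ LinearMap.ker B.mulVecLin := by
    intro x hx
    rw [LinearMap.mem_ker, mulVecLin_apply] at hx ⊢
    ext k
    exact congrFun hx (Fin.castLE hr k)
  have hker : LinearMap.ker A.mulVecLin = LinearMap.ker B.mulVecLin := by
    apply Submodule.eq_of_le_of_finrank_le hle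
    have hA' := A.mulVecLin.finrank_range_add_finrank_ker
    have hB' := B.mulVecLin.finrank_range_add_finrank_ker
    rw [← Matrix.rank] at hA' hB'
    omega
  set E : Matrix (Fin d) (Fin r) F := (1 : Matrix (Fin d) (Fin d) F).submatrix id (Fin.castLE hr)
  have hAE : A * E = headCols hr A := by
    ext i k; simp [E, headCols, Matrix.mul_apply, Matrix.one_apply]
  have hBE : B * E = P := by
    ext i k; simp [E, hB, hP, headBlock, Matrix.mul_apply, Matrix.one_apply]
  have key : ∀ x : Fin d → F, A *ᵥ ((P.det • (1 : Matrix (Fin d) (Fin d) F) -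
      E * P.adjugate * B) *ᵥ x) = 0 := by
    intro x
    have : (P.det • (1 : Matrix (Fin d) (Fin d) F) - E * P.adjugate * B) *ᵥ x ∈
        LinearMap.ker A.mulVecLin := by
      rw [hker, LinearMap.mem_ker, mulVecLin_apply, mulVec_mulVec, Matrix.mul_sub,
        ← Matrix.mul_assoc, ← Matrix.mul_assoc, hBE, mul_adjugate]
      simp
    simpa using this
  have h0 : A * (P.det • (1 : Matrix (Fin d) (Fin d) F) - E * P.adjugate * B) = 0 := by
    apply Matrix.ext_of_mulVec_single
    intro i
    rw [← mulVec_mulVec, key, zero_mulVec]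
  rw [Matrix.mul_sub, Matrix.mul_smul, Matrix.mul_one, ← Matrix.mul_assoc, ← Matrix.mul_assoc,
    hAE, sub_eq_zero] at h0
  rw [h0, adjProduct, hBC]

/-- The symmetric matrix of rank at most `r` with prescribed independent entries. -/
noncomputable def chart (hr : r ≤ d) (a : Coord d r → F) : Matrix (Fin d) (Fin d) F :=
  (headBlock hr (fill a)).det⁻¹ • adjProduct hr (fill a)

theorem chart_coords (hr : r ≤ d) {A : Matrix (Fin d) (Fin d) F}
    (hA : A.IsSymm) (hrank : A.rank ≤ r) (hdet : (headBlock hr A).det ≠ 0) :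
    chart hr (coords A) = A := by
  rw [chart, headBlock_fill_coords hr hA, adjProduct_fill_coords hr hA,
    ← det_headBlock_smul_eq_adjProduct hr hA hrank hdet, smul_smul, inv_mul_cancel₀ hdet, one_smul]

theorem chart_isSymm (hr : r ≤ d) (a : Coord d r → F) : (chart hr a).IsSymm :=
  (adjProduct_isSymm hr (fill_isSymm a)).smul _

theorem headCols_chart (hr : r ≤ d) {a : Coord d r → F} (ha : (headBlock hr (fill a)).det ≠ 0) :
    headCols hr (chart hr a) = headCols hr (fill a) := by
  have : headCols hr (chart hr a) =
    (headBlock hr (fill a)).det⁻¹ • headCols hr (adjProduct hr (fill a)) := rfl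
  rw [this, headCols_adjProduct hr (fill_isSymm a), smul_smul, inv_mul_cancel₀ ha, one_smul]

theorem headBlock_chart (hr : r ≤ d) {a : Coord d r → F} (ha : (headBlock hr (fill a)).det ≠ 0) :
    headBlock hr (chart hr a) = headBlock hr (fill a) := by
  rw [headBlock_eq, headBlock_eq, headCols_chart hr ha]

theorem coords_chart (hr : r ≤ d) {a : Coord d r → F} (ha : (headBlock hr (fill a)).det ≠ 0) :
    coords (chart hr a) = a := by
  ext p
  have h := congrFun (congrFun (headCols_chart hr ha) p.1.2) ⟨p.1.1, p.2.2⟩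
  change chart hr a p.1.2 p.1.1 = fill a p.1.2 p.1.1 at h
  rw [(chart_isSymm hr a).apply, (fill_isSymm a).apply, fill_coord] at h
  exact h

theorem rank_chart (hr : r ≤ d) {a : Coord d r → F} (ha : (headBlock hr (fill a)).det ≠ 0) :
    (chart hr a).rank = r := by
  apply le_antisymm
  · have : chart hr a = headCols hr (fill a) * ((headBlock hr (fill a)).det⁻¹ •
        ((headBlock hr (fill a)).adjugate * (headCols hr (fill a))ᵀ)) := by
      rw [chart, adjProduct, Matrix.mul_smul, Matrix.mul_assoc]
    rw [this]
    exact (rank_mul_le_left _ _).trans ((rank_le_card_width _).trans (by simp))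
  · have h1 : (headBlock hr (chart hr a)).rank = r := by
      rw [headBlock_chart hr ha]; simpa using rank_of_det_ne_zero ha
    exact h1.symm.le.trans (rank_submatrix_le _ _ _)

end Rank

/-- A real symmetric form is nondegenerate on the range of its matrix, since range and kernel are
orthogonal. The first `r` columns of `G` are a basis of that range; the others are zero, as `G` need
not be invertible. -/
theorem exists_det_headBlock_congr_ne_zero {d r : ℕ} (hr : r ≤ d) {A : Matrix (Fin d) (Fin d) ℝ}
    (hA : A.IsSymm) (hrank : A.rank = r) :
    ∃ G : Matrix (Fin d) (Fin d) ℝ, (headBlock hr (Gᵀ * A * G)).det ≠ 0 := by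
  let b := Module.finBasisOfFinrankEq ℝ (LinearMap.range A.mulVecLin) hrank
  let G : Matrix (Fin d) (Fin d) ℝ := of fun i k =>
    if h : (k : ℕ) < r then (b ⟨k, h⟩ : Fin d → ℝ) i else 0
  refine ⟨G, fun h => ?_⟩
  set G' := headCols hr G with hG'
  have hG'b : ∀ k i, G' i k = (b k : Fin d → ℝ) i := by
    intro k i
    simp only [hG', headCols, G, submatrix_apply, of_apply, id, Fin.val_castLE,
      Fin.is_lt, dif_pos, Fin.eta]
  have hhead : headBlock hr (Gᵀ * A * G) = G'ᵀ * A * G' := rfl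
  rw [hhead] at h
  obtain ⟨c, hc, hc0⟩ := exists_mulVec_eq_zero_iff.2 h
  have hy : G' *ᵥ c = ((∑ k, c k • b k : LinearMap.range A.mulVecLin) : Fin d → ℝ) := by
    ext i
    simp [mulVec, dotProduct, hG'b, mul_comm]
  set y := ∑ k, c k • b k with hydef
  have hort : ∀ w : LinearMap.range A.mulVecLin, (w : Fin d → ℝ) ⬝ᵥ (A *ᵥ (y : Fin d → ℝ)) = 0 := by
    intro w
    have hb : ∀ k, (b k : Fin d → ℝ) ⬝ᵥ (A *ᵥ (y : Fin d → ℝ)) = 0 := by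
      intro k
      have := congrFun hc0 k
      rw [← mulVec_mulVec, ← mulVec_mulVec, hy] at this
      simpa [mulVec, dotProduct, hG'b] using this
    rw [← b.sum_repr w, AddSubmonoidClass.coe_finsetSum, sum_dotProduct]
    exact Finset.sum_eq_zero fun k _ => by
      rw [Submodule.coe_smul, smul_dotProduct, hb, smul_zero]
  have h1 : A *ᵥ (y : Fin d → ℝ) = 0 := by
    have := hort ⟨A *ᵥ (y : Fin d → ℝ), ⟨_, rfl⟩⟩
    exact dotProduct_self_eq_zero.1 this
  have h2 : (y : Fin d → ℝ) = 0 := by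
    obtain ⟨z, hz⟩ := y.2
    rw [mulVecLin_apply] at hz
    apply dotProduct_self_eq_zero.1
    nth_rewrite 1 [← hz]
    rw [dotProduct_comm, dotProduct_mulVec, ← mulVec_transpose, hA.eq, h1, zero_dotProduct]
  have h3 : y = 0 := Subtype.ext h2
  apply hc
  ext k
  exact Fintype.linearIndependent_iff.1 b.linearIndependent c h3 k

/-! ### Counting parameters by transcendence degree -/

/-- Adjoining algebraic functions of a finite set `B` destroys the independence of at most
`B.ncard` members of an algebraically independent family. -/
theorem exists_algebraicIndependent_subalgebra {k K σ : Type*} [Field k] [Field K] [Algebra k K]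
    [Finite σ] {x : σ → K} (hx : AlgebraicIndependent k x) (B : Set K) (hB : B.Finite) :
    ∃ (L : Subalgebra k K) (J : Set σ), B ⊆ L ∧ Jᶜ.ncard ≤ B.ncard ∧
      AlgebraicIndependent L (fun i : J => x i) := by
  classical
  set M := AlgebraicIndependent.matroid k K
  obtain ⟨B₀, hB₀⟩ := M.exists_isBasis B
  obtain ⟨B₁, hB₁, hB₀₁⟩ := hB₀.indep.subset_isBasis_of_subset
    (hB₀.subset.trans Set.subset_union_left : B₀ ⊆ B ∪ Set.range x)
  have hI : M.Indep (Set.range x) := by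
    rw [AlgebraicIndependent.matroid_indep_iff]
    exact hx.to_subtype_range
  have hB₁fin : B₁.Finite := (hB.union (Set.finite_range x)).subset hB₁.subset
  have hdiff : B₁ \ B₀ ⊆ Set.range x := by
    rintro b ⟨hb, hb0⟩
    rcases hB₁.subset hb with h | h
    · exact absurd (hB₀.mem_of_insert_indep h (hB₁.indep.subset (Set.insert_subset hb hB₀₁))) hb0
    · exact h
  have hcard : (Set.range x).ncard ≤ B₁.ncard := by
    obtain ⟨I', hI', hsub⟩ := hI.subset_isBasis_of_subset
      (Set.subset_union_right : Set.range x ⊆ B ∪ Set.range x)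
    have h1 := hI'.encard_eq_encard hB₁
    have h2 : I'.Finite := (hB.union (Set.finite_range x)).subset hI'.subset
    calc (Set.range x).ncard ≤ I'.ncard := Set.ncard_le_ncard hsub h2
      _ = B₁.ncard := by rw [Set.ncard, Set.ncard, h1]
  have hind : AlgebraicIndependent k ((↑) : B₁ → K) :=
    AlgebraicIndependent.matroid_indep_iff.1 hB₁.indep
  have hind' : AlgebraicIndependent (Algebra.adjoin k B₀)
      (fun i : (B₁ \ B₀ : Set K) => (i : K)) := by
    have hdis : Disjoint {b : B₁ | (b : K) ∈ B₀} {b : B₁ | (b : K) ∉ B₀} :=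
      Set.disjoint_left.2 fun _ h h' => h' h
    have h := hind.adjoin_of_disjoint hdis
    have himg : ((↑) : B₁ → K) '' {b : B₁ | (b : K) ∈ B₀} = B₀ := by
      ext b; exact ⟨by rintro ⟨b, hb, rfl⟩; exact hb, fun hb => ⟨⟨b, hB₀₁ hb⟩, hb, rfl⟩⟩
    rw [himg] at h
    exact h.comp (fun i : (B₁ \ B₀ : Set K) => ⟨⟨i, i.2.1⟩, i.2.2⟩) fun i j hij => by
      simpa [Subtype.ext_iff] using hij
  -- Passing to the algebraic closure inside `K` captures all of `B`, not only `B₀`, and keeps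
  -- independence.
  have hind'' := hind'.subalgebraAlgebraicClosure
  refine ⟨(Subalgebra.algebraicClosure (Algebra.adjoin k B₀) K).restrictScalars k,
    x ⁻¹' (B₁ \ B₀), ?_, ?_, ?_⟩
  · intro b hb
    exact (AlgebraicIndependent.matroid_isBasis_iff.1 hB₀).2.2 b hb
  · have h1 : (x ⁻¹' (B₁ \ B₀))ᶜ.ncard ≤ (Set.range x \ (B₁ \ B₀)).ncard :=
      Set.ncard_le_ncard_of_injOn x (fun i hi => ⟨⟨i, rfl⟩, hi⟩) hx.injective.injOn
        ((Set.finite_range x).sdiff)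
    have h2 := Set.ncard_sdiff_add_ncard_of_subset hdiff (Set.finite_range x)
    have h3 := Set.ncard_sdiff_add_ncard_of_subset hB₀₁ hB₁fin
    have h4 := Set.ncard_le_ncard hB₀.subset hB
    omega
  · exact hind''.comp (fun i : x ⁻¹' (B₁ \ B₀) => (⟨x i, i.2⟩ : (B₁ \ B₀ : Set K)))
      fun i j hij => Subtype.ext (hx.injective (congrArg Subtype.val hij))

/-- Symmetric matrices of prescribed ranks with algebraically independent coordinates have no
common pair of nonzero orthogonal vectors, once there are at least `2d - 1` of them. -/
theorem not_algebraicIndependent_coords {k K : Type*} [Field k] [Field K] [Algebra k K]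
    {d N : ℕ} (hN : 2 * d ≤ N + 1) {r : Fin N → ℕ} (hr0 : ∀ j, 0 < r j) (hr : ∀ j, r j ≤ d)
    {a : (Σ j, Coord d (r j)) → K} (ha : AlgebraicIndependent k a) {u v : Fin d → K}
    (hu : u ≠ 0) (hv : v ≠ 0) :
    ∃ j, u ⬝ᵥ adjProduct (hr j) (fill fun p => a ⟨j, p⟩) *ᵥ v ≠ 0 := by
  classical
  by_contra! hcon
  obtain ⟨i₀, hi₀⟩ := Function.ne_iff.1 hu
  obtain ⟨k₀, hk₀⟩ := Function.ne_iff.1 hv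
  rw [Pi.zero_apply] at hi₀ hk₀
  -- Scaling one entry of each vector to 1 leaves `2(d-1)` entries to adjoin; this saving gives the
  -- bound `2d - 1`.
  set u' := (u i₀)⁻¹ • u with hu'
  set v' := (v k₀)⁻¹ • v with hv'
  have hu1 : u' i₀ = 1 := by simp [hu', hi₀]
  have hv1 : v' k₀ = 1 := by simp [hv', hk₀]
  set B : Set K := u' '' {i₀}ᶜ ∪ v' '' {k₀}ᶜ with hB
  have hBcard : B.ncard ≤ 2 * (d - 1) := by
    have hc : ∀ i : Fin d, ({i}ᶜ : Set (Fin d)).ncard = d - 1 := by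
      intro i; rw [Set.ncard_compl, Set.ncard_singleton, Nat.card_fin]
    have h1 := Set.ncard_union_le (u' '' {i₀}ᶜ) (v' '' {k₀}ᶜ)
    have h2 := Set.ncard_image_le (f := u') (Set.toFinite {i₀}ᶜ)
    have h3 := Set.ncard_image_le (f := v') (Set.toFinite {k₀}ᶜ)
    rw [hc] at h2 h3
    rw [hB]
    omega
  obtain ⟨L, J, hBL, hJ, hind⟩ := exists_algebraicIndependent_subalgebra ha B (Set.toFinite B)
  have huL : ∀ i, u' i ∈ L := by
    intro i
    by_cases h : i = i₀
    · rw [h, hu1]; exact one_mem L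
    · exact hBL (Or.inl ⟨i, h, rfl⟩)
  have hvL : ∀ i, v' i ∈ L := by
    intro i
    by_cases h : i = k₀
    · rw [h, hv1]; exact one_mem L
    · exact hBL (Or.inr ⟨i, h, rfl⟩)
  -- Otherwise each of the `N` matrices loses a coordinate, forcing `N ≤ 2(d-1)`.
  obtain ⟨j, hj⟩ : ∃ j, ∀ p : Coord d (r j), (⟨j, p⟩ : Σ j, Coord d (r j)) ∈ J := by
    by_contra! h
    choose p hp using h
    have h1 : (Set.univ : Set (Fin N)).ncard ≤ Jᶜ.ncard :=
      Set.ncard_le_ncard_of_injOn (fun j => (⟨j, p j⟩ : Σ j, Coord d (r j)))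
        (fun j _ => hp j) (fun i _ j _ hij => congrArg Sigma.fst hij)
    rw [Set.ncard_univ, Nat.card_fin] at h1
    have : 0 < d := Fin.pos i₀
    omega
  have hindj : AlgebraicIndependent L (fun p : Coord d (r j) => a ⟨j, p⟩) :=
    hind.comp (fun p : Coord d (r j) => (⟨⟨j, p⟩, hj p⟩ : J)) fun p q hpq => by
      simpa using congrArg Subtype.val hpq
  let uL : Fin d → L := fun i => ⟨u' i, huL i⟩
  let vL : Fin d → L := fun i => ⟨v' i, hvL i⟩
  have huL0 : uL ≠ 0 := fun h => one_ne_zero (hu1.symm.trans (congrArg Subtype.val (congrFun h i₀)))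
  have hvL0 : vL ≠ 0 := fun h => one_ne_zero (hv1.symm.trans (congrArg Subtype.val (congrFun h k₀)))
  refine dotProduct_adjProduct_fill_X_ne_zero (hr j) (hr0 j) huL0 hvL0
    (hindj.eq_zero_of_aeval_eq_zero _ ?_)
  set φ : MvPolynomial (Coord d (r j)) L →ₐ[L] K :=
    MvPolynomial.aeval (fun p : Coord d (r j) => a ⟨j, p⟩)
  have hC : ∀ w : Fin d → L, φ.toRingHom ∘ MvPolynomial.C ∘ w = fun i => (w i : K) := by
    intro w; ext1 i; exact MvPolynomial.algHom_C φ (w i)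
  have hX : φ.toRingHom ∘ MvPolynomial.X = fun p : Coord d (r j) => a ⟨j, p⟩ := by
    ext1 p; exact MvPolynomial.aeval_X _ _
  change φ.toRingHom _ = 0
  rw [map_dotProduct_adjProduct_fill, hX, hC, hC]
  change u' ⬝ᵥ _ *ᵥ v' = 0
  rw [hu', hv', mulVec_smul, dotProduct_smul, smul_dotProduct, hcon j, smul_zero, smul_zero]

/-! ### From algebraic independence to a real polynomial, by ultraproducts -/

/-- A family of real points satisfying no common nonzero polynomial equation is generic along some
ultrafilter. -/
theorem exists_ultrafilter_eventually_eval_ne_zero {X σ : Type*} (a : X → σ → ℝ)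
    (h : ∀ g : MvPolynomial σ ℝ, g ≠ 0 → ∃ x, MvPolynomial.eval (a x) g ≠ 0) :
    ∃ φ : Ultrafilter X, ∀ g : MvPolynomial σ ℝ, g ≠ 0 →
      ∀ᶠ x in (φ : Filter X), MvPolynomial.eval (a x) g ≠ 0 := by
  let F : Filter X := ⨅ g : {g : MvPolynomial σ ℝ // g ≠ 0},
    Filter.principal {x | MvPolynomial.eval (a x) g.1 ≠ 0}
  have : Nonempty {g : MvPolynomial σ ℝ // g ≠ 0} := ⟨⟨1, one_ne_zero⟩⟩
  have : F.NeBot := by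
    apply Filter.iInf_neBot_of_directed'
    · rintro ⟨f, hf⟩ ⟨g, hg⟩
      refine ⟨⟨f * g, mul_ne_zero hf hg⟩, ?_, ?_⟩ <;>
      · refine Filter.principal_mono.2 fun x hx => ?_
        rw [Set.mem_ofPred_eq, map_mul] at hx
        first | exact left_ne_zero_of_mul hx | exact right_ne_zero_of_mul hx
    · rintro ⟨g, hg⟩
      exact Filter.principal_neBot_iff.2 (h g hg)
  refine ⟨Ultrafilter.of F, fun g hg => Ultrafilter.of_le F ?_⟩
  exact Filter.mem_iInf_of_mem (⟨g, hg⟩ : {g : MvPolynomial σ ℝ // g ≠ 0})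
    (Filter.mem_principal_self _)

/-- The coordinates of tuples admitting a common pair of nonzero orthogonal vectors satisfy a
nontrivial polynomial equation. -/
theorem exists_polynomial_vanishing_of_orthogonal {d N : ℕ} (hN : 2 * d ≤ N + 1) {r : Fin N → ℕ}
    (hr0 : ∀ j, 0 < r j) (hr : ∀ j, r j ≤ d) {X : Type*} (a : X → (Σ j, Coord d (r j)) → ℝ)
    (u v : X → Fin d → ℝ) (hu : ∀ x, u x ≠ 0) (hv : ∀ x, v x ≠ 0)
    (horth : ∀ x j, u x ⬝ᵥ adjProduct (hr j) (fill fun p => a x ⟨j, p⟩) *ᵥ v x = 0) :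
    ∃ g : MvPolynomial (Σ j, Coord d (r j)) ℝ, g ≠ 0 ∧ ∀ x, MvPolynomial.eval (a x) g = 0 := by
  by_contra! hcon
  obtain ⟨φ, hφ⟩ := exists_ultrafilter_eventually_eval_ne_zero a hcon
  -- Germs along an ultrafilter form a field, in which the coordinate functions become algebraically
  -- independent over `ℝ` while all the orthogonality relations persist.
  let germ : (X → ℝ) →+* Filter.Germ (φ : Filter X) ℝ := Filter.Germ.coeRingHom (φ : Filter X)
  let _ : Algebra ℝ (Filter.Germ (φ : Filter X) ℝ) := (germ.comp (Pi.constRingHom X ℝ)).toAlgebra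
  have hgerm : ∀ f : X → ℝ, germ f = 0 ↔ ∀ᶠ x in (φ : Filter X), f x = 0 := fun f =>
    Filter.Germ.coe_eq
  have ha : AlgebraicIndependent ℝ (fun c => germ fun x => a x c) := by
    rw [algebraicIndependent_iff]
    intro g hg
    by_contra hg0
    have heval : (MvPolynomial.aeval fun c => germ fun x => a x c).toRingHom =
        germ.comp (RingHom.pi fun x => MvPolynomial.eval (a x)) := by
      apply MvPolynomial.ringHom_ext
      · intro t
        refine (MvPolynomial.algHom_C _ t).trans (congrArg germ ?_)
        ext x
        exact (MvPolynomial.eval_C t).symm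
      · intro c
        refine (MvPolynomial.aeval_X _ c).trans (congrArg germ ?_)
        ext x
        exact (MvPolynomial.eval_X c).symm
    have h1 : germ (fun x => MvPolynomial.eval (a x) g) = 0 :=
      (congrArg (fun f => f g) heval).symm.trans hg
    obtain ⟨x, hx, hx'⟩ := (((hgerm _).1 h1).and (hφ g hg0)).exists
    exact hx' hx
  have hne : ∀ w : X → Fin d → ℝ, (∀ x, w x ≠ 0) → (fun i => germ fun x => w x i) ≠ 0 := by
    intro w hw h0
    have h1 : ∀ᶠ x in (φ : Filter X), ∀ i, w x i = 0 :=
      Filter.eventually_all.2 fun i => (hgerm _).1 (congrFun h0 i)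
    obtain ⟨x, hx⟩ := h1.exists
    exact hw x (funext hx)
  obtain ⟨j, hj⟩ := not_algebraicIndependent_coords hN hr0 hr ha (hne u hu) (hne v hv)
  apply hj
  have h1 := map_dotProduct_adjProduct_fill (hr j) germ (fun p x => a x ⟨j, p⟩)
    (fun i x => u x i) (fun i x => v x i)
  refine h1.symm.trans ((congrArg germ ?_).trans (map_zero germ))
  ext x
  have h2 := map_dotProduct_adjProduct_fill (hr j) (Pi.evalRingHom (fun _ : X => ℝ) x)
    (fun p x => a x ⟨j, p⟩) (fun i x => u x i) (fun i x => v x i)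
  exact h2.trans (horth x j)

/-! ### Images of rational maps and drop of dimension -/

section RationalMap

variable {σ τ : Type*} {D : MvPolynomial σ ℝ} {φ : (σ → ℝ) → τ → ℝ}

/-- Pulling back a polynomial along a rational map with denominator `D` gives a polynomial divided
by a power of `D`. -/
theorem exists_numerator
    (hφ : ∀ t, ∃ G : MvPolynomial σ ℝ, ∀ a, MvPolynomial.eval a D ≠ 0 →
      MvPolynomial.eval a D * φ a t = MvPolynomial.eval a G) (f : MvPolynomial τ ℝ) :
    ∃ (F : MvPolynomial σ ℝ) (n : ℕ), ∀ a, MvPolynomial.eval a D ≠ 0 →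
      MvPolynomial.eval a F = MvPolynomial.eval a D ^ n * MvPolynomial.eval (φ a) f := by
  induction f using MvPolynomial.induction_on with
  | C c => exact ⟨MvPolynomial.C c, 0, fun a _ => by simp⟩
  | add p q hp hq =>
    obtain ⟨F, m, hF⟩ := hp
    obtain ⟨G, n, hG⟩ := hq
    refine ⟨F * D ^ n + G * D ^ m, m + n, fun a ha => ?_⟩
    simp only [map_add, map_mul, map_pow, hF a ha, hG a ha]
    ring
  | mul_X p t hp =>
    obtain ⟨F, n, hF⟩ := hp
    obtain ⟨G, hG⟩ := hφ t
    refine ⟨F * G, n + 1, fun a ha => ?_⟩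
    simp only [map_mul, hF a ha, ← hG a ha, MvPolynomial.eval_X]
    ring

variable (hD : D ≠ 0) (hφ : ∀ t, ∃ G : MvPolynomial σ ℝ, ∀ a, MvPolynomial.eval a D ≠ 0 →
  MvPolynomial.eval a D * φ a t = MvPolynomial.eval a G)

include hD hφ

/-- A product of infinite sets is Zariski dense, and clearing denominators reduces to a polynomial.
-/
theorem eval_rationalMap_eq_zero_of_box (s : σ → Set ℝ) (hs : ∀ c, (s c).Infinite)
    (f : MvPolynomial τ ℝ)
    (hf : ∀ a, (∀ c, a c ∈ s c) → MvPolynomial.eval a D ≠ 0 → MvPolynomial.eval (φ a) f = 0)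
    (a : σ → ℝ) (ha : MvPolynomial.eval a D ≠ 0) : MvPolynomial.eval (φ a) f = 0 := by
  obtain ⟨F, n, hF⟩ := exists_numerator hφ f
  have h : F * D = 0 := by
    refine MvPolynomial.funext_set s hs fun b hb => ?_
    rw [map_mul, map_zero]
    by_cases hbD : MvPolynomial.eval b D = 0
    · rw [hbD, mul_zero]
    · rw [hF b hbD, hf b (fun c => hb c trivial) hbD, mul_zero, zero_mul]
  have h0 := hF a ha
  rw [(mul_eq_zero.1 h).resolve_right hD, map_zero] at h0
  exact (mul_eq_zero.1 h0.symm).resolve_left (pow_ne_zero n ha)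

/-- Pulling back and clearing denominators turns vanishing on the image into vanishing of a
polynomial, and the polynomial ring is a domain. -/
theorem vanishingIdeal_range_rationalMap_isPrime :
    (idealOf (φ '' {a | MvPolynomial.eval a D ≠ 0})).IsPrime := by
  have hmem : ∀ f, f ∈ idealOf (φ '' {a | MvPolynomial.eval a D ≠ 0}) ↔
      ∀ a, MvPolynomial.eval a D ≠ 0 → MvPolynomial.eval (φ a) f = 0 := by
    intro f
    rw [idealOf, MvPolynomial.mem_vanishingIdeal_iff, Set.forall_mem_image]
    simp only [MvPolynomial.aeval_eq_eval, Set.mem_ofPred_eq]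
  obtain ⟨a₀, ha₀⟩ : ∃ a, MvPolynomial.eval a D ≠ 0 := by
    by_contra! h
    exact hD (MvPolynomial.funext fun a => by rw [h a, map_zero])
  refine ⟨fun h => ?_, fun {f g} hfg => ?_⟩
  · have h1 := (hmem 1).1 (h ▸ Submodule.mem_top) a₀ ha₀
    rw [map_one] at h1
    exact one_ne_zero h1
  · obtain ⟨F, m, hF⟩ := exists_numerator hφ f
    obtain ⟨G, n, hG⟩ := exists_numerator hφ g
    have h : F * G * D = 0 := by
      refine MvPolynomial.funext fun a => ?_
      rw [map_mul, map_mul, map_zero]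
      by_cases ha : MvPolynomial.eval a D = 0
      · rw [ha, mul_zero]
      · have := (hmem _).1 hfg a ha
        rw [map_mul] at this
        rw [hF a ha, hG a ha, mul_mul_mul_comm, this, mul_zero, zero_mul]
    rcases mul_eq_zero.1 ((mul_eq_zero.1 h).resolve_right hD) with h0 | h0
    · refine Or.inl ((hmem f).2 fun a ha => ?_)
      have h1 := hF a ha
      rw [h0, map_zero] at h1
      exact (mul_eq_zero.1 h1.symm).resolve_left (pow_ne_zero m ha)
    · refine Or.inr ((hmem g).2 fun a ha => ?_)
      have h1 := hG a ha
      rw [h0, map_zero] at h1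
      exact (mul_eq_zero.1 h1.symm).resolve_left (pow_ne_zero n ha)

end RationalMap

/-- The class of `f` is a nonzerodivisor in the domain `ℝ[x]/I(T)` and dies in `ℝ[x]/I(Z)`, so the
Krull dimension drops by at least one. The drop is strict because the dimension is bounded by the
number of variables. -/
theorem realDim_lt_of_isPrime {τ : Type*} [Finite τ] {Z T : Set (τ → ℝ)}
    (hT : (idealOf T).IsPrime) (hle : idealOf T ≤ idealOf Z) {f : MvPolynomial τ ℝ}
    (hfZ : f ∈ idealOf Z) (hfT : f ∉ idealOf T) : realDim Z < realDim T := by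
  have h1 : realDim Z + 1 ≤ realDim T := by
    refine ringKrullDim_succ_le_of_surjective (Ideal.Quotient.factor hle)
      (Ideal.Quotient.factor_surjective hle) (r := Ideal.Quotient.mk _ f)
      (mem_nonZeroDivisors_of_ne_zero fun h => hfT (Ideal.Quotient.eq_zero_iff_mem.1 h)) ?_
    rw [Ideal.Quotient.factor_mk]
    exact Ideal.Quotient.eq_zero_iff_mem.2 hfZ
  have h2 : realDim T ≤ (Nat.card τ : ℕ) := by
    refine (ringKrullDim_quotient_le (idealOf T)).trans ?_
    rw [MvPolynomial.ringKrullDim_of_isNoetherianRing, ringKrullDim_eq_zero_of_field, zero_add]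
  have h3 : 0 ≤ realDim T := ringKrullDim_nonneg_of_nontrivial
  generalize realDim Z = x at *
  generalize realDim T = y at *
  induction x with
  | bot => exact lt_of_lt_of_le (WithBot.bot_lt_coe 0) h3
  | coe x =>
    induction y with
    | bot => simp at h3
    | coe y =>
      have hy : y ≤ (Nat.card τ : ℕ∞) := by exact_mod_cast h2
      have hxy : x + 1 ≤ y := by exact_mod_cast h1
      have hx : x ≠ ⊤ := by
        rintro rfl
        exact absurd (hxy.trans hy) (by simp)
      exact_mod_cast (ENat.add_one_le_iff hx).1 hxy

/-! ### Positive semidefinite points of the chart -/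

/-- A symmetric matrix with sufficiently dominant diagonal is positive semidefinite. -/
theorem posSemidef_of_dominant_diag {n : ℕ} {P : Matrix (Fin n) (Fin n) ℝ} (hP : P.IsSymm)
    (hdiag : ∀ i, (n : ℝ) ≤ P i i) (hoff : ∀ i k, i ≠ k → |P i k| ≤ 1) : P.PosSemidef := by
  refine PosSemidef.of_dotProduct_mulVec_nonneg
    (by rw [IsHermitian, conjTranspose_eq_transpose_of_trivial, hP.eq]) fun x => ?_
  have hterm : ∀ i k, -(x i ^ 2 + x k ^ 2) / 2 + (if i = k then (P i i + 1) * x i ^ 2 else 0) ≤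
      x i * (P i k * x k) := by
    intro i k
    split_ifs with h
    · subst h; linarith [sq_nonneg (x i)]
    · have h1 : |x i * (P i k * x k)| ≤ |x i| * |x k| := by
        rw [abs_mul, abs_mul]
        exact mul_le_mul_of_nonneg_left
          (mul_le_of_le_one_left (abs_nonneg _) (hoff i k h)) (abs_nonneg _)
      have h2 := neg_abs_le (x i * (P i k * x k))
      have h3 := sq_nonneg (|x i| - |x k|)
      rw [← sq_abs (x i), ← sq_abs (x k)]
      linarith
  have hsum := Finset.sum_le_sum fun i (_ : i ∈ Finset.univ) =>
    Finset.sum_le_sum fun k (_ : k ∈ Finset.univ) => hterm i k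
  have hR : ∑ i, ∑ k, x i * (P i k * x k) = star x ⬝ᵥ P *ᵥ x := by
    simp [dotProduct, mulVec, Finset.mul_sum]
  rw [hR] at hsum
  refine le_trans ?_ hsum
  simp only [Finset.sum_add_distrib, Finset.sum_ite_eq, Finset.mem_univ, if_true,
    ← Finset.sum_div, Finset.sum_neg_distrib, Finset.sum_const, Finset.card_univ,
    Fintype.card_fin, nsmul_eq_mul, ← Finset.mul_sum]
  have h4 : (n : ℝ) * ∑ i, x i ^ 2 ≤ ∑ i, (P i i + 1) * x i ^ 2 := by
    rw [Finset.mul_sum]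
    exact Finset.sum_le_sum fun i _ =>
      mul_le_mul_of_nonneg_right ((hdiag i).trans (by linarith)) (sq_nonneg _)
  linarith

/-- The chart is `C P⁻¹ Cᵀ`; inversion and congruence preserve positive semidefiniteness. -/
theorem chart_posSemidef {d r : ℕ} (hr : r ≤ d) {a : Coord d r → ℝ}
    (hP : (headBlock hr (fill a)).PosSemidef) : (chart hr a).PosSemidef := by
  have h := hP.inv.mul_mul_conjTranspose_same (headCols hr (fill a))
  rwa [inv_def, Ring.inverse_eq_inv', conjTranspose_eq_transpose_of_trivial, Matrix.mul_smul,
    Matrix.smul_mul] at h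

/-! ### The common vanishing ideal of both sets of tuples -/

section Tuples

variable {d N : ℕ} {r : Fin N → ℕ} (hr : ∀ j, r j ≤ d)

/-- The product of the leading minors of the tuple with given coordinates. -/
noncomputable def minorProduct : MvPolynomial (Σ j, Coord d (r j)) ℝ :=
  ∏ j, (headBlock (hr j) (fill fun p => MvPolynomial.X ⟨j, p⟩)).det

/-- The entries of the tuple with given coordinates. -/
noncomputable def tupleChart (a : (Σ j, Coord d (r j)) → ℝ) : Fin N × Fin d × Fin d → ℝ :=
  entries fun j => chart (hr j) fun p => a ⟨j, p⟩

theorem eval_minorProduct (a : (Σ j, Coord d (r j)) → ℝ) :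
    MvPolynomial.eval a (minorProduct hr) =
      ∏ j, (headBlock (hr j) (fill fun p => a ⟨j, p⟩)).det := by
  rw [minorProduct, map_prod]
  refine Finset.prod_congr rfl fun j _ => ?_
  rw [← det_headBlock_map, fill_map]
  congr 3
  ext p
  simp

theorem exists_tupleChart_numerator (t : Fin N × Fin d × Fin d) :
    ∃ G : MvPolynomial (Σ j, Coord d (r j)) ℝ, ∀ a, MvPolynomial.eval a (minorProduct hr) ≠ 0 →
      MvPolynomial.eval a (minorProduct hr) * tupleChart hr a t = MvPolynomial.eval a G := by
  obtain ⟨j, i, k⟩ := t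
  let M : Matrix (Fin d) (Fin d) (MvPolynomial (Σ j, Coord d (r j)) ℝ) :=
    fill fun p : Coord d (r j) => MvPolynomial.X ⟨j, p⟩
  refine ⟨(∏ l ∈ Finset.univ.erase j,
    (headBlock (hr l) (fill fun p => MvPolynomial.X ⟨l, p⟩)).det) * adjProduct (hr j) M i k,
    fun a ha => ?_⟩
  have hM : M.map (MvPolynomial.eval a) = fill fun p : Coord d (r j) => a ⟨j, p⟩ := by
    rw [fill_map]
    congr 1
    ext p
    simp
  have hsplit : minorProduct hr = (∏ l ∈ Finset.univ.erase j,
      (headBlock (hr l) (fill fun p => MvPolynomial.X ⟨l, p⟩)).det) * (headBlock (hr j) M).det :=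
    (Finset.prod_erase_mul _ _ (Finset.mem_univ j)).symm
  rw [hsplit, map_mul] at ha ⊢
  rw [map_mul, mul_assoc]
  congr 1
  have hdet := right_ne_zero_of_mul ha
  rw [← det_headBlock_map, hM] at hdet ⊢
  have hadj : MvPolynomial.eval a (adjProduct (hr j) M i k) =
      adjProduct (hr j) (fill fun p : Coord d (r j) => a ⟨j, p⟩) i k := by
    rw [← hM, adjProduct_map, map_apply]
  rw [hadj]
  simp only [tupleChart, entries, chart, Matrix.smul_apply, smul_eq_mul]
  rw [mul_inv_cancel_left₀ hdet]

theorem minorProduct_ne_zero : minorProduct hr ≠ 0 := by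
  intro h
  have h1 := eval_minorProduct hr (fun c => if c.2.1.1 = c.2.1.2 then 1 else 0)
  rw [h, map_zero] at h1
  refine Finset.prod_ne_zero_iff.2 (fun j _ => ?_) h1.symm
  have h2 : headBlock (hr j) (fill fun p : Coord d (r j) => if p.1.1 = p.1.2 then (1 : ℝ) else 0) =
      1 := by
    ext i k
    have hmin : ((min (Fin.castLE (hr j) i) (Fin.castLE (hr j) k) : Fin d) : ℕ) < r j :=
      lt_of_le_of_lt (Fin.le_def.1 (min_le_left _ _)) (by simp)
    have hiff : min (Fin.castLE (hr j) i) (Fin.castLE (hr j) k) =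
        max (Fin.castLE (hr j) i) (Fin.castLE (hr j) k) ↔ i = k := by simp
    simp only [headBlock, submatrix_apply, fill, hmin, dif_pos, hiff, one_apply]
  rw [h2, det_one]
  exact one_ne_zero

theorem mem_vanishing_tupleChart {f : MvPolynomial (Fin N × Fin d × Fin d) ℝ} :
    f ∈ idealOf (tupleChart hr '' {a | MvPolynomial.eval a (minorProduct hr) ≠ 0}) ↔
      ∀ a, MvPolynomial.eval a (minorProduct hr) ≠ 0 →
        MvPolynomial.eval (tupleChart hr a) f = 0 := by
  rw [idealOf, MvPolynomial.mem_vanishingIdeal_iff, Set.forall_mem_image]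
  simp only [MvPolynomial.aeval_eq_eval, Set.mem_ofPred_eq]

theorem entries_eq_tupleChart {A : Fin N → Matrix (Fin d) (Fin d) ℝ} (hA : ∀ j, (A j).IsSymm)
    (hrank : ∀ j, (A j).rank ≤ r j) (hdet : ∀ j, (headBlock (hr j) (A j)).det ≠ 0) :
    MvPolynomial.eval (fun c => coords (r := r c.1) (A c.1) c.2) (minorProduct hr) ≠ 0 ∧
      entries A = tupleChart hr (fun c => coords (r := r c.1) (A c.1) c.2) := by
  constructor
  · rw [eval_minorProduct]
    refine Finset.prod_ne_zero_iff.2 fun j _ => ?_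
    change (headBlock (hr j) (fill (coords (A j)))).det ≠ 0
    rw [headBlock_fill_coords (hr j) (hA j)]
    exact hdet j
  · rw [tupleChart]
    congr 1
    ext1 j
    exact (chart_coords (hr j) (hA j) (hrank j) (hdet j)).symm

/-- A polynomial vanishing on the tuples with invertible leading blocks vanishes on all symmetric
tuples of the prescribed ranks. -/
theorem eval_entries_eq_zero_of_mem_vanishing {f : MvPolynomial (Fin N × Fin d × Fin d) ℝ}
    (hf : f ∈ idealOf (tupleChart hr '' {a | MvPolynomial.eval a (minorProduct hr) ≠ 0}))
    {A : Fin N → Matrix (Fin d) (Fin d) ℝ} (hA : A ∈ symmetricTuples r) :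
    MvPolynomial.eval (entries A) f = 0 := by
  choose G hG using fun j => exists_det_headBlock_congr_ne_zero (hr j) (hA j).1 (hA j).2
  -- The line `H t = 1 + t (G - 1)` moves `A` by congruence without raising ranks. The minors are
  -- nonzero at `t = 1`, hence for all but finitely many `t`; so `f` vanishes along the whole curve,
  -- including at `t = 0`, where it passes through `A`.
  let H : Fin N → Matrix (Fin d) (Fin d) (Polynomial ℝ) := fun j =>
    1 + (Polynomial.X : Polynomial ℝ) • ((G j - 1).map Polynomial.C)
  let B : Fin N → Matrix (Fin d) (Fin d) (Polynomial ℝ) := fun j =>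
    (H j)ᵀ * (A j).map Polynomial.C * H j
  have hHt : ∀ t j, (H j).map (Polynomial.evalRingHom t) = 1 + t • (G j - 1) := by
    intro t j
    ext i k
    by_cases h : i = k
    · simp [H, h]
    · simp [H, h, mul_comm (G j i k) t]
  have hBt : ∀ t j, (B j).map (Polynomial.evalRingHom t) =
      (1 + t • (G j - 1))ᵀ * A j * (1 + t • (G j - 1)) := by
    intro t j
    rw [Matrix.map_mul, Matrix.map_mul, ← hHt t j, transpose_map]
    congr 2
    ext i k
    simp
  let q : Polynomial ℝ := MvPolynomial.aeval (fun c => B c.1 c.2.1 c.2.2) f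
  let δ : Polynomial ℝ := ∏ j, (headBlock (hr j) (B j)).det
  have hδ : ∀ t, Polynomial.eval t δ =
      ∏ j, (headBlock (hr j) ((B j).map (Polynomial.evalRingHom t))).det := by
    intro t
    rw [Polynomial.eval_prod]
    exact Finset.prod_congr rfl fun j _ => (det_headBlock_map _ (Polynomial.evalRingHom t) _).symm
  have hq : ∀ t, Polynomial.eval t q =
      MvPolynomial.eval (entries fun j => (B j).map (Polynomial.evalRingHom t)) f := by
    intro t
    have h := MvPolynomial.map_aeval (fun c : Fin N × Fin d × Fin d => B c.1 c.2.1 c.2.2)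
      (Polynomial.evalRingHom t) f
    refine h.trans ?_
    have hid : (Polynomial.evalRingHom t).comp (algebraMap ℝ (Polynomial ℝ)) = RingHom.id ℝ := by
      ext x; simp
    rw [hid]
    rfl
  have hδ0 : δ ≠ 0 := by
    intro h0
    have h1 := hδ 1
    rw [h0, Polynomial.eval_zero] at h1
    refine Finset.prod_ne_zero_iff.2 (fun j _ => ?_) h1.symm
    rw [hBt, one_smul, add_sub_cancel]
    exact hG j
  have hqδ : q * δ = 0 := by
    refine Polynomial.funext fun t => ?_
    rw [Polynomial.eval_mul, Polynomial.eval_zero]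
    by_cases ht : Polynomial.eval t δ = 0
    · rw [ht, mul_zero]
    · rw [hδ] at ht
      have hdet := fun j => Finset.prod_ne_zero_iff.1 ht j (Finset.mem_univ j)
      obtain ⟨h1, h2⟩ := entries_eq_tupleChart hr
        (A := fun j => (B j).map (Polynomial.evalRingHom t))
        (fun j => by
          rw [hBt, Matrix.IsSymm, transpose_mul, transpose_mul, transpose_transpose, (hA j).1.eq,
            Matrix.mul_assoc])
        (fun j => by
          rw [hBt]
          exact (rank_mul_le_left _ _).trans ((rank_mul_le_right _ _).trans (hA j).2.le)) hdet
      rw [hq, h2, (mem_vanishing_tupleChart hr).1 hf _ h1, zero_mul]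
  have h0 := hq 0
  rw [(mul_eq_zero.1 hqδ).resolve_right hδ0, Polynomial.eval_zero] at h0
  have hB0 : (fun j => (B j).map (Polynomial.evalRingHom 0)) = A := by
    ext1 j
    rw [hBt]
    simp
  rw [h0, hB0]

/-- A polynomial vanishing on the positive semidefinite tuples of the prescribed ranks vanishes on
all tuples with invertible leading blocks. -/
theorem mem_vanishing_of_posSemidefTuples {f : MvPolynomial (Fin N × Fin d × Fin d) ℝ}
    (hf : ∀ A ∈ posSemidefTuples (d := d) r, MvPolynomial.eval (entries A) f = 0) :
    f ∈ idealOf (tupleChart hr '' {a | MvPolynomial.eval a (minorProduct hr) ≠ 0}) := by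
  rw [mem_vanishing_tupleChart]
  refine eval_rationalMap_eq_zero_of_box (minorProduct_ne_zero hr)
    (exists_tupleChart_numerator hr)
    -- On this box every leading block has dominant diagonal, since `r j ≤ d`, so the chart takes
    -- positive semidefinite values.
    (fun c => if c.2.1.1 = c.2.1.2 then Set.Ici (d : ℝ) else Set.Icc 0 1) (fun c => ?_) f ?_
  · split_ifs
    · exact Set.Ici_infinite _
    · exact Set.Icc_infinite zero_lt_one
  · intro a ha hdet
    rw [eval_minorProduct] at hdet
    refine hf _ fun j => ?_
    have hdet := Finset.prod_ne_zero_iff.1 hdet j (Finset.mem_univ j)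
    refine ⟨chart_posSemidef (hr j) (posSemidef_of_dominant_diag
      (headBlock_isSymm (hr j) (fill_isSymm _)) (fun i => ?_) (fun i k hik => ?_)),
      rank_chart (hr j) hdet⟩
    · have h1 := ha ⟨j, ⟨(Fin.castLE (hr j) i, Fin.castLE (hr j) i), le_rfl, by simp⟩⟩
      rw [if_pos rfl] at h1
      simp only [headBlock, submatrix_apply, fill, min_self, max_self, Fin.val_castLE, Fin.is_lt,
        dif_pos]
      exact le_trans (by exact_mod_cast hr j) h1
    · have hmin : ((min (Fin.castLE (hr j) i) (Fin.castLE (hr j) k) : Fin d) : ℕ) < r j :=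
        lt_of_le_of_lt (Fin.le_def.1 (min_le_left _ _)) (by simp)
      have h1 := ha ⟨j, ⟨(min (Fin.castLE (hr j) i) (Fin.castLE (hr j) k),
        max (Fin.castLE (hr j) i) (Fin.castLE (hr j) k)), min_le_max, hmin⟩⟩
      have hne : min (Fin.castLE (hr j) i) (Fin.castLE (hr j) k) ≠
          max (Fin.castLE (hr j) i) (Fin.castLE (hr j) k) := fun h =>
        hik (Fin.castLE_injective (hr j) (by simpa using h))
      rw [if_neg hne] at h1
      simp only [headBlock, submatrix_apply, fill, hmin, dif_pos]
      rw [abs_of_nonneg h1.1]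
      exact h1.2

theorem idealOf_entries_eq {T : Set (Fin N → Matrix (Fin d) (Fin d) ℝ)}
    (hT : posSemidefTuples r ⊆ T) (hT' : T ⊆ symmetricTuples r) :
    idealOf (entries '' T) =
      idealOf (tupleChart hr '' {a | MvPolynomial.eval a (minorProduct hr) ≠ 0}) := by
  ext f
  have hmem : f ∈ idealOf (entries '' T) ↔ ∀ A ∈ T, MvPolynomial.eval (entries A) f = 0 := by
    rw [idealOf, MvPolynomial.mem_vanishingIdeal_iff, Set.forall_mem_image]
    simp only [MvPolynomial.aeval_eq_eval]
  rw [hmem]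
  exact ⟨fun h => mem_vanishing_of_posSemidefTuples hr fun A hA => h A (hT hA),
    fun h A hA => eval_entries_eq_zero_of_mem_vanishing hr h (hT' hA)⟩

end Tuples

/-! ### Bad tuples and the exceptional algebraic set -/

theorem exists_orthogonal_of_not_isPhaseRetrievable {d N : ℕ}
    {A : Fin N → Matrix (Fin d) (Fin d) ℝ} (hA : ∀ j, (A j).IsSymm) (h : ¬ IsPhaseRetrievable A) :
    ∃ u v : Fin d → ℝ, u ≠ 0 ∧ v ≠ 0 ∧ ∀ j, u ⬝ᵥ A j *ᵥ v = 0 := by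
  contrapose! h
  intro x y
  refine Quotient.inductionOn₂ x y fun x y hxy => Quotient.sound ?_
  change ∃ b : ℝ, |b| = 1 ∧ x = b • y
  by_cases hu : x + y = 0
  · exact ⟨-1, by simp, by rw [neg_one_smul]; exact eq_neg_of_add_eq_zero_left hu⟩
  by_cases hv : x - y = 0
  · exact ⟨1, by simp, by rw [one_smul]; exact sub_eq_zero.1 hv⟩
  obtain ⟨j, hj⟩ := h _ _ hu hv
  have h1 : x ⬝ᵥ A j *ᵥ x = y ⬝ᵥ A j *ᵥ y := congrFun hxy j
  have h2 : x ⬝ᵥ A j *ᵥ y = y ⬝ᵥ A j *ᵥ x := by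
    rw [dotProduct_mulVec, ← mulVec_transpose, (hA j).eq, dotProduct_comm]
  refine absurd ?_ hj
  rw [mulVec_sub, add_dotProduct, dotProduct_sub, dotProduct_sub, h1, h2]
  ring

theorem holdsGenerically_isPhaseRetrievable {d N : ℕ} (hN : 2 * d ≤ N + 1) {r : Fin N → ℕ}
    (hr0 : ∀ j, 0 < r j) (hr : ∀ j, r j ≤ d) {T : Set (Fin N → Matrix (Fin d) (Fin d) ℝ)}
    (hT : posSemidefTuples r ⊆ T) (hT' : T ⊆ symmetricTuples r) :
    HoldsGenerically T IsPhaseRetrievable := by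
  have hI := idealOf_entries_eq hr hT hT'
  let X := {x : (Fin N → Matrix (Fin d) (Fin d) ℝ) × (Fin d → ℝ) × (Fin d → ℝ) //
    (∀ j, (x.1 j).IsSymm ∧ (x.1 j).rank ≤ r j ∧ (headBlock (hr j) (x.1 j)).det ≠ 0) ∧
      x.2.1 ≠ 0 ∧ x.2.2 ≠ 0 ∧ ∀ j, x.2.1 ⬝ᵥ x.1 j *ᵥ x.2.2 = 0}
  obtain ⟨g, hg0, hg⟩ := exists_polynomial_vanishing_of_orthogonal hN hr0 hr
    (fun (x : X) c => coords (r := r c.1) (x.1.1 c.1) c.2) (fun x => x.1.2.1) (fun x => x.1.2.2)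
    (fun x => x.2.2.1) (fun x => x.2.2.2.1) (fun x j => by
      obtain ⟨⟨A, u, v⟩, hA, -, -, horth⟩ := x
      change u ⬝ᵥ adjProduct (hr j) (fill (coords (A j))) *ᵥ v = 0
      rw [adjProduct_fill_coords (hr j) (hA j).1,
        ← det_headBlock_smul_eq_adjProduct (hr j) (hA j).1 (hA j).2.1 (hA j).2.2, smul_mulVec,
        dotProduct_smul, horth j, smul_zero])
  let ι : (Σ j, Coord d (r j)) → Fin N × Fin d × Fin d := fun c => (c.1, c.2.1.1, c.2.1.2)
  -- The minors make `f` vanish also at bad tuples outside the chart, where `g` gives no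
  -- information.
  let f : MvPolynomial (Fin N × Fin d × Fin d) ℝ := MvPolynomial.rename ι g *
    ∏ j, (headBlock (hr j) (Matrix.of fun i k => MvPolynomial.X (j, i, k))).det
  have hf : ∀ A : Fin N → Matrix (Fin d) (Fin d) ℝ, MvPolynomial.eval (entries A) f =
      MvPolynomial.eval (fun c => coords (r := r c.1) (A c.1) c.2) g *
        ∏ j, (headBlock (hr j) (A j)).det := by
    intro A
    rw [map_mul, MvPolynomial.eval_rename, map_prod]
    congr 1
    refine Finset.prod_congr rfl fun j _ => ?_
    rw [← det_headBlock_map]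
    congr 2
    ext i k
    simp [entries]
  -- The equations of `T` are kept: the hypersurface `f = 0` alone lives in the space of all
  -- matrices and could have too large a dimension.
  refine ⟨{x | ∀ h ∈ {h | h = f ∨ h ∈ idealOf (entries '' T)}, MvPolynomial.eval x h = 0},
    ⟨_, rfl⟩, realDim_lt_of_isPrime ?_ ?_ (f := f) ?_ ?_, ?_⟩
  · rw [hI]
    exact vanishingIdeal_range_rationalMap_isPrime (minorProduct_ne_zero hr)
      (exists_tupleChart_numerator hr)
  · intro h hh
    exact MvPolynomial.mem_vanishingIdeal_iff.2 fun x hx => hx h (Or.inr hh)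
  · exact MvPolynomial.mem_vanishingIdeal_iff.2 fun x hx => hx f (Or.inl rfl)
  · rw [hI, mem_vanishing_tupleChart]
    intro h
    -- Pulled back through the chart, `f` is `g * minorProduct hr`, a nonzero polynomial.
    refine mul_ne_zero hg0 (minorProduct_ne_zero hr) (MvPolynomial.funext fun a => ?_)
    rw [map_mul, map_zero]
    by_cases ha : MvPolynomial.eval a (minorProduct hr) = 0
    · rw [ha, mul_zero]
    · have h1 := h a ha
      rw [eval_minorProduct] at ha ⊢
      have hdet := fun j => Finset.prod_ne_zero_iff.1 ha j (Finset.mem_univ j)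
      rw [tupleChart, hf] at h1
      simp only [headBlock_chart _ (hdet _), coords_chart _ (hdet _)] at h1
      exact h1
  · intro A hA hZ
    by_contra hbad
    have hsymm := hT' hA
    obtain ⟨u, v, hu, hv, horth⟩ :=
      exists_orthogonal_of_not_isPhaseRetrievable (fun j => (hsymm j).1) hbad
    refine hZ ?_
    rintro h (rfl | hh)
    · rw [hf]
      by_cases hdet : ∀ j, (headBlock (hr j) (A j)).det ≠ 0
      · have h1 := hg ⟨(A, u, v), fun j => ⟨(hsymm j).1, (hsymm j).2.le, hdet j⟩, hu, hv, horth⟩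
        rw [h1, zero_mul]
      · push Not at hdet
        obtain ⟨j, hj⟩ := hdet
        rw [Finset.prod_eq_zero (Finset.mem_univ j) hj, mul_zero]
    · exact MvPolynomial.mem_vanishingIdeal_iff.1 hh _ ⟨A, hA, rfl⟩

theorem posSemidefTuples_subset_symmetricTuples {d N : ℕ} (r : Fin N → ℕ) :
    (posSemidefTuples r : Set (Fin N → Matrix (Fin d) (Fin d) ℝ)) ⊆ symmetricTuples r :=
  fun A hA j => ⟨by
    have h := (hA j).1.isHermitian
    rwa [IsHermitian, conjTranspose_eq_transpose_of_trivial] at h, (hA j).2⟩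

end PhaseRetrieval

theorem mainTheorem4 (d N : ℕ) (hN : 2 * (d : ℤ) - 1 ≤ (N : ℤ)) (r : Fin N → ℕ)
    (hr : ∀ j, 1 ≤ r j ∧ r j ≤ d) :
    PhaseRetrieval.HoldsGenerically
        (PhaseRetrieval.symmetricTuples (d := d) r) PhaseRetrieval.IsPhaseRetrievable ∧
      PhaseRetrieval.HoldsGenerically
        (PhaseRetrieval.posSemidefTuples (d := d) r) PhaseRetrieval.IsPhaseRetrievable := by
  have hsub := PhaseRetrieval.posSemidefTuples_subset_symmetricTuples (d := d) r
  have hN' : 2 * d ≤ N + 1 := by omega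
  exact ⟨PhaseRetrieval.holdsGenerically_isPhaseRetrievable hN' (fun j => (hr j).1)
      (fun j => (hr j).2) hsub subset_rfl,
    PhaseRetrieval.holdsGenerically_isPhaseRetrievable hN' (fun j => (hr j).1)
      (fun j => (hr j).2) subset_rfl hsub⟩
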